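/- For $x\in[0,1]$ put $d_1(x)=\lfloor 1/x\rfloor$ and $T(x)=1-d_1(x)\,x$ if $x\neq 0$, and $d_1(0)=\infty$, $T(0)=0$. For $k\ge 1$ let $d_k(x)=d_1(T^{k-1}(x))\in\mathbb{N}\cup\{\infty\}$ be the $k$-th digit of the Pierce expansion of $x$. For $\alpha\in[0,\infty]$ let $$A(\alpha)=\Bigl\{x\in[0,1] : \lim_{n\to\infty}\frac{\log d_n(x)}{n}=\alpha\Bigr\},$$ where $\log\infty=\infty$ and the limit is taken in the extended real numbers. Then, for every $\alpha\in[0,\infty]$: (i) $A(\alpha)$ is dense in $[0,1]$; (ii) for every non-empty (relatively) open subset $U$ of $[0,1]$, the set $U\cap A(\alpha)$ has Hausdorff dimension $1$. -/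

import Mathlib

open scoped unitInterval ENNReal

noncomputable section

namespace Pierce

/-- The first Pierce digit: `⌊1/x⌋` if `x ≠ 0`, and `∞` if `x = 0`. -/
def firstDigit (x : I) : ℕ∞ :=
  if (x : ℝ) = 0 then ⊤ else (⌊1 / (x : ℝ)⌋₊ : ℕ∞)

theorem one_sub_floor_mul_mem (x : I) (hx : (x : ℝ) ≠ 0) :
    1 - (⌊1 / (x : ℝ)⌋₊ : ℝ) * (x : ℝ) ∈ I := by
  have hpos : 0 < (x : ℝ) := lt_of_le_of_ne x.2.1 (Ne.symm hx)
  have h1 : (⌊1 / (x : ℝ)⌋₊ : ℝ) ≤ 1 / (x : ℝ) := Nat.floor_le (by positivity)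
  have h2 : (⌊1 / (x : ℝ)⌋₊ : ℝ) * (x : ℝ) ≤ 1 := (le_div_iff₀ hpos).mp h1
  have h3 : 0 ≤ (⌊1 / (x : ℝ)⌋₊ : ℝ) * (x : ℝ) := by positivity
  exact ⟨by linarith, by linarith⟩

/-- The Pierce map `T : [0,1] → [0,1]`: `T x = 1 - ⌊1/x⌋ x` if `x ≠ 0`, and `T 0 = 0`. -/
def shift (x : I) : I :=
  if hx : (x : ℝ) = 0 then 0
  else ⟨1 - (⌊1 / (x : ℝ)⌋₊ : ℝ) * (x : ℝ), one_sub_floor_mul_mem x hx⟩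

/-- The `k`-th digit `d_k(x) = d_1(T^{k-1}(x))`, for `k ≥ 1`
(the value at `k = 0` carries no meaning). -/
def digit (k : ℕ) (x : I) : ℕ∞ :=
  firstDigit (shift^[k - 1] x)

/-- The set `A(α)` of all `x ∈ [0,1]` with `(log d_n(x)) / n → α`, where `log ∞ = ∞`;
the quotients and the limit are taken in the extended reals. -/
def growthSet (α : ℝ≥0∞) : Set I :=
  {x | Filter.Tendsto (fun n : ℕ => ENNReal.log ((digit n x : ℕ∞) : ℝ≥0∞) / (n : EReal))
    Filter.atTop (nhds (α : EReal))}

end Pierce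

end

open Filter Topology Finset

namespace Pierce

/-! Membership in `growthSet α` depends only on the tail of the digits, and the growth rate leaves
each digit a large window of free choices. Take `h` with `h n / n → α` and `M k = ⌈exp (h (k +
i))⌉`. Any choice of `d k` in `[M k, M (k + 1))` is strictly increasing, hence the digit sequence of
a Pierce series, and `log (d k)` follows `h` closely enough (`mem_growthSet_of_window`).

Coding `t ∈ [0, 1)` in mixed radix by these choices gives points whose inverse coding is `r`-Hölder
for any prescribed `r < 1`, once `i` is large (`le_abs_pierceSeries_sub`, `exists_codedDigit_ne`,
`eventually_window`). Hence the dimension is at least `r`.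

To localize in `U`, pick a rational point of `U`. Its expansion is finite, so an iterated inverse
branch maps a neighbourhood of `0` affinely into `U` (`hasNearbyBranches_of_rational`). This only
prepends finitely many digits and rescales distances. Density follows since the empty set has
dimension `0`. -/

/-! ### Dimension bounds from a Hölder inverse -/

/-- The bound forces `F` to be injective on `[0, 1)`, and its inverse is an `r`-Hölder map from a
subset of `X` onto a set of dimension `1`; such a map multiplies dimension by at most `1 / r`. -/
theorem le_dimH_of_le_mul_rpow {X : Set I} {r : ℝ} (hr : 0 < r) {C : ℝ} (hC : 0 ≤ C)
    {F : ℝ → I} (hFX : ∀ t ∈ Set.Ico (0 : ℝ) 1, F t ∈ X)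
    (hF : ∀ t ∈ Set.Ico (0 : ℝ) 1, ∀ u ∈ Set.Ico (0 : ℝ) 1,
      |t - u| ≤ C * |(F t : ℝ) - F u| ^ r) :
    ENNReal.ofReal r ≤ dimH X := by
  have hinj : Set.InjOn F (Set.Ico 0 1) := by
    intro t ht u hu h
    have := hF t ht u hu
    rw [h, sub_self, abs_zero, Real.zero_rpow hr.ne', mul_zero] at this
    exact sub_eq_zero.mp (abs_nonpos_iff.mp this)
  set G := Function.invFunOn F (Set.Ico (0 : ℝ) 1)
  have hG : ∀ t ∈ Set.Ico (0 : ℝ) 1, G (F t) = t := fun t ht => hinj.leftInvOn_invFunOn ht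
  have hH : HolderOnWith C.toNNReal r.toNNReal G (F '' Set.Ico 0 1) := by
    rintro _ ⟨t, ht, rfl⟩ _ ⟨u, hu, rfl⟩
    rw [hG t ht, hG u hu, edist_dist, edist_dist, Real.coe_toNNReal r hr.le,
      ENNReal.ofReal_rpow_of_nonneg dist_nonneg hr.le, ← ENNReal.ofReal_coe_nnreal,
      Real.coe_toNNReal C hC, ← ENNReal.ofReal_mul hC]
    exact ENNReal.ofReal_le_ofReal (hF t ht u hu)
  have h1 : dimH (Set.Ico (0 : ℝ) 1) = 1 := by
    have h : (interior (Set.Ico (0 : ℝ) 1)).Nonempty := by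
      rw [interior_Ico]; exact Set.nonempty_Ioo.mpr one_pos
    simpa using Real.dimH_of_nonempty_interior h
  have h2 : G '' (F '' Set.Ico 0 1) = Set.Ico 0 1 := by
    rw [Set.image_image]
    exact (Set.image_congr hG).trans (Set.image_id' _)
  have h3 := hH.dimH_image_le (by simpa using hr)
  rw [h2, h1] at h3
  have h4 : dimH (F '' Set.Ico 0 1) ≤ dimH X :=
    dimH_mono (Set.image_subset_iff.mpr hFX)
  have h5 : ((r.toNNReal : NNReal) : ℝ≥0∞) = ENNReal.ofReal r := rfl
  rw [h5] at h3
  have h6 := (ENNReal.le_div_iff_mul_le (by simp [hr]) (by simp)).mp h3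
  rw [one_mul] at h6
  exact h6.trans h4

/-! ### Inverse branches of the Pierce map -/

theorem inverseBranch_mem {d : ℕ} (hd : 0 < d) (y : I) : (1 - (y : ℝ)) / d ∈ I := by
  have hd' : (1 : ℝ) ≤ d := by exact_mod_cast hd
  have := y.2.1
  have := y.2.2
  refine ⟨div_nonneg (by linarith) (by linarith), ?_⟩
  rw [div_le_one (by linarith)]
  linarith

/-- The inverse branch `y ↦ (1 - y) / d` of the Pierce map. -/
noncomputable def inverseBranch {d : ℕ} (hd : 0 < d) (y : I) : I := ⟨(1 - (y : ℝ)) / d, inverseBranch_mem hd y⟩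

theorem inverseBranch_pos {d : ℕ} (hd : 0 < d) {y : I} (hy : (y : ℝ) < 1 / (d + 1)) :
    0 < (1 - (y : ℝ)) / d := by
  have hd' : (1 : ℝ) ≤ d := by exact_mod_cast hd
  have : (1 : ℝ) / (d + 1) ≤ 1 := by rw [div_le_one (by linarith)]; linarith
  exact div_pos (by linarith) (by linarith)

/-- The hypothesis on `y` is equivalent to `(1 - y) / d > 1 / (d + 1)`, the strict end of the
interval of points with first digit `d`. -/
theorem floor_inverseBranch {d : ℕ} (hd : 0 < d) {y : I} (hy : (y : ℝ) < 1 / (d + 1)) :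
    ⌊1 / ((1 - (y : ℝ)) / d)⌋₊ = d := by
  have hd' : (1 : ℝ) ≤ d := by exact_mod_cast hd
  have hpos := inverseBranch_pos hd hy
  have h0 := y.2.1
  rw [lt_div_iff₀ (by linarith)] at hy
  rw [Nat.floor_eq_iff (by positivity), le_div_iff₀ hpos, div_lt_iff₀ hpos]
  constructor
  · rw [mul_div_cancel₀ _ (by linarith)]; linarith
  · rw [mul_div_assoc', lt_div_iff₀ (by linarith)]; nlinarith

theorem firstDigit_inverseBranch {d : ℕ} (hd : 0 < d) {y : I} (hy : (y : ℝ) < 1 / (d + 1)) :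
    firstDigit (inverseBranch hd y) = d := by
  have h0 : ((inverseBranch hd y : I) : ℝ) ≠ 0 := (inverseBranch_pos hd hy).ne'
  rw [firstDigit, if_neg h0]
  exact congrArg Nat.cast (floor_inverseBranch hd hy)

theorem shift_inverseBranch {d : ℕ} (hd : 0 < d) {y : I} (hy : (y : ℝ) < 1 / (d + 1)) :
    shift (inverseBranch hd y) = y := by
  have hd' : (d : ℝ) ≠ 0 := by exact_mod_cast hd.ne'
  have h0 : ((inverseBranch hd y : I) : ℝ) ≠ 0 := (inverseBranch_pos hd hy).ne'
  rw [shift, dif_neg h0]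
  ext
  simp only [inverseBranch, floor_inverseBranch hd hy]
  field_simp
  ring

/-- Near `0`, some iterated inverse branch is affine and takes values arbitrarily close to `x`. -/
def HasNearbyBranches (x : I) : Prop :=
  ∀ ε > (0 : ℝ), ∃ (m : ℕ) (a b δ : ℝ), b ≠ 0 ∧ 0 < δ ∧ ∀ y : I, (y : ℝ) < δ →
    ∃ z : I, (z : ℝ) = a + b * y ∧ shift^[m] z = y ∧ |(z : ℝ) - x| < ε

theorem HasNearbyBranches.of_shift {x : I} (hx : (x : ℝ) ≠ 0) (h : HasNearbyBranches (shift x)) :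
    HasNearbyBranches x := by
  intro ε hε
  have hx0 : 0 < (x : ℝ) := lt_of_le_of_ne x.2.1 (Ne.symm hx)
  set d := ⌊1 / (x : ℝ)⌋₊ with hd_def
  have hd : 0 < d := Nat.floor_pos.mpr ((one_le_div hx0).mpr x.2.2)
  have hd1 : (1 : ℝ) ≤ d := by exact_mod_cast hd
  have hd0 : (d : ℝ) ≠ 0 := by linarith
  have hT : (shift x : ℝ) = 1 - d * x := by simp [shift, hx, hd_def]
  have hlt : (shift x : ℝ) < 1 / (d + 1) := by
    have := Nat.lt_floor_add_one (1 / (x : ℝ))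
    rw [← hd_def, div_lt_iff₀ hx0] at this
    rw [hT, lt_div_iff₀ (by linarith)]
    nlinarith
  -- The second term of the minimum keeps `z` below `1 / (d + 1)`, where `inverseBranch hd` is
  -- inverted by `shift`.
  obtain ⟨m, a, b, δ, hb, hδ, H⟩ := h (min ε (1 / (d + 1) - shift x)) (lt_min hε (by linarith))
  refine ⟨m + 1, (1 - a) / d, -b / d, δ, div_ne_zero (neg_ne_zero.mpr hb) hd0, hδ, fun y hy => ?_⟩
  obtain ⟨z, hz, hzm, hzx⟩ := H y hy
  have h1 := hzx.trans_le (min_le_left _ _)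
  have h2 := (le_abs_self _).trans_lt (hzx.trans_le (min_le_right _ _))
  have hz' : (z : ℝ) < 1 / (d + 1) := by linarith
  refine ⟨inverseBranch hd z, ?_, ?_, ?_⟩
  · simp only [inverseBranch, hz]; ring
  · rw [Function.iterate_succ_apply, shift_inverseBranch hd hz', hzm]
  · have : ((inverseBranch hd z : I) : ℝ) - x = -((z : ℝ) - shift x) / d := by
      simp only [inverseBranch, hT]; field_simp; ring
    rw [this, abs_div, abs_neg, abs_of_pos (by linarith : (0 : ℝ) < d)]
    exact (div_le_self (abs_nonneg _) hd1).trans_lt h1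

/-- The Pierce map sends `p / q` to `(q % p) / q`, so the numerator decreases until the orbit
reaches `0`, where the identity branch serves. -/
theorem hasNearbyBranches_of_rational {q : ℕ} (hq : 0 < q) (p : ℕ) :
    ∀ x : I, (x : ℝ) = p / q → HasNearbyBranches x := by
  induction p using Nat.strong_induction_on with
  | _ p ih =>
    intro x hx
    rcases Nat.eq_zero_or_pos p with rfl | hp
    · intro ε hε
      refine ⟨0, 0, 1, ε, one_ne_zero, hε, fun y hy => ⟨y, by ring, rfl, ?_⟩⟩
      rw [hx, Nat.cast_zero, zero_div, sub_zero, abs_of_nonneg y.2.1]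
      exact hy
    · have hp' : (p : ℝ) ≠ 0 := by exact_mod_cast hp.ne'
      have hq' : (q : ℝ) ≠ 0 := by exact_mod_cast hq.ne'
      have hx0 : (x : ℝ) ≠ 0 := by rw [hx]; exact div_ne_zero hp' hq'
      refine .of_shift hx0 (ih (q % p) (Nat.mod_lt _ hp) _ ?_)
      have hf : ⌊1 / (x : ℝ)⌋₊ = q / p := by rw [hx, one_div_div, Nat.floor_div_eq_div]
      simp only [shift, hx0, dite_false, hf]
      have : (q : ℝ) = p * (q / p : ℕ) + (q % p : ℕ) := by exact_mod_cast (Nat.div_add_mod q p).symm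
      rw [hx]
      field_simp
      linarith

theorem exists_mem_hasNearbyBranches {U : Set I} (hU : IsOpen U) (hne : U.Nonempty) :
    ∃ x ∈ U, HasNearbyBranches x := by
  obtain ⟨x, hx⟩ := hne
  obtain ⟨ε, hε, hball⟩ := Metric.isOpen_iff.mp hU x hx
  obtain ⟨n, hn⟩ := exists_nat_gt (1 / ε)
  have hn0 : (0 : ℝ) < n := lt_trans (by positivity) hn
  have hx0 := x.2.1
  have hfl := Nat.floor_le (mul_nonneg hn0.le hx0)
  have hfl' := Nat.lt_floor_add_one ((n : ℝ) * x)
  have h1 : ((⌊(n : ℝ) * x⌋₊ : ℝ) / n) ≤ x := by rw [div_le_iff₀ hn0]; linarith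
  let z : I := ⟨(⌊(n : ℝ) * x⌋₊ : ℝ) / n, by positivity, h1.trans x.2.2⟩
  refine ⟨z, hball ?_, hasNearbyBranches_of_rational (by exact_mod_cast hn0) _ z rfl⟩
  rw [Metric.mem_ball, Subtype.dist_eq, Real.dist_eq, abs_sub_comm,
    abs_of_nonneg (sub_nonneg.mpr h1)]
  rw [div_lt_iff₀ hε] at hn
  change (x : ℝ) - (⌊(n : ℝ) * x⌋₊ : ℝ) / n < ε
  rw [sub_lt_iff_lt_add, ← sub_lt_iff_lt_add', lt_div_iff₀ hn0]
  nlinarith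

/-! ### Pierce series with prescribed digits -/

/-- The Pierce series `1 / d₀ - 1 / (d₀ d₁) + 1 / (d₀ d₁ d₂) - ⋯`. -/
noncomputable def pierceSeries (d : ℕ → ℕ) : ℝ :=
  ∑' n, (-1) ^ n * (∏ i ∈ range (n + 1), (d i : ℝ))⁻¹

section Series

variable {d : ℕ → ℕ}

theorem pos_of_strictMono (hd : StrictMono d) (h0 : 0 < d 0) (n : ℕ) : 0 < d n :=
  h0.trans_le (hd.monotone (Nat.zero_le n))

theorem two_pow_le_prod (hd : StrictMono d) (h0 : 0 < d 0) (n : ℕ) :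
    (2 : ℝ) ^ n ≤ ∏ i ∈ range (n + 1), (d i : ℝ) := by
  induction n with
  | zero => simpa using Nat.one_le_iff_ne_zero.mpr h0.ne'
  | succ n ih =>
    rw [prod_range_succ, pow_succ]
    have : 2 ≤ d (n + 1) := by
      have := hd (Nat.lt_add_one n)
      have := pos_of_strictMono hd h0 n
      omega
    have : (2 : ℝ) ≤ d (n + 1) := by exact_mod_cast this
    gcongr

theorem inv_prod_le (hd : StrictMono d) (h0 : 0 < d 0) (n : ℕ) :
    (∏ i ∈ range (n + 1), (d i : ℝ))⁻¹ ≤ (1 / 2) ^ n := by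
  rw [one_div, inv_pow]
  exact inv_anti₀ (by positivity) (two_pow_le_prod hd h0 n)

theorem summable_pierceSeries (hd : StrictMono d) (h0 : 0 < d 0) :
    Summable fun n => (-1 : ℝ) ^ n * (∏ i ∈ range (n + 1), (d i : ℝ))⁻¹ := by
  refine Summable.of_norm_bounded (g := fun n : ℕ => (1 / 2 : ℝ) ^ n)
    summable_geometric_two fun n => ?_
  rw [norm_mul, norm_pow, norm_neg, norm_one, one_pow, one_mul,
    Real.norm_of_nonneg (by positivity)]
  exact inv_prod_le hd h0 n

theorem antitone_inv_prod (hd : StrictMono d) (h0 : 0 < d 0) :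
    Antitone fun n => (∏ i ∈ range (n + 1), (d i : ℝ))⁻¹ := by
  refine antitone_nat_of_succ_le fun n => ?_
  rw [prod_range_succ _ (n + 1), mul_inv]
  refine mul_le_of_le_one_right (by positivity) (inv_le_one_of_one_le₀ ?_)
  exact_mod_cast pos_of_strictMono hd h0 (n + 1)

theorem pierceSeries_nonneg (hd : StrictMono d) (h0 : 0 < d 0) : 0 ≤ pierceSeries d := by
  simpa [pierceSeries] using (antitone_inv_prod hd h0).alternating_series_le_tendsto
    (summable_pierceSeries hd h0).hasSum.tendsto_sum_nat 0

theorem pierceSeries_le (hd : StrictMono d) (h0 : 0 < d 0) : pierceSeries d ≤ 1 / d 0 := by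
  simpa [pierceSeries] using (antitone_inv_prod hd h0).tendsto_le_alternating_series
    (summable_pierceSeries hd h0).hasSum.tendsto_sum_nat 0

theorem pierceSeries_eq (hd : StrictMono d) (h0 : 0 < d 0) :
    pierceSeries d = (1 - pierceSeries fun k => d (k + 1)) / d 0 := by
  rw [pierceSeries, (summable_pierceSeries hd h0).tsum_eq_zero_add, pierceSeries, sub_div,
    sub_eq_add_neg, ← neg_div, ← tsum_neg, ← tsum_div_const]
  congr 1
  · simp
  · refine tsum_congr fun n => ?_
    rw [prod_range_succ' _ (n + 1), pow_succ, mul_inv]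
    ring

theorem strictMono_tail (hd : StrictMono d) : StrictMono fun k => d (k + 1) :=
  fun _ _ h => hd (Nat.succ_lt_succ h)

theorem pierceSeries_pos (hd : StrictMono d) (h0 : 0 < d 0) : 0 < pierceSeries d := by
  rw [pierceSeries_eq hd h0]
  have h1 : d 0 < d 1 := hd Nat.zero_lt_one
  have h2 : (1 : ℝ) / d 1 < 1 := by
    rw [div_lt_one (by exact_mod_cast h0.trans h1)]
    exact_mod_cast (by omega : 1 < d 1)
  have h3 := pierceSeries_le (strictMono_tail hd) (h0.trans h1)
  simp only [zero_add] at h3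
  exact div_pos (by linarith) (by exact_mod_cast h0)

theorem pierceSeries_lt (hd : StrictMono d) (h0 : 0 < d 0) : pierceSeries d < 1 / d 0 := by
  have := pierceSeries_pos (strictMono_tail hd) (h0.trans (hd Nat.zero_lt_one))
  have h0' : (0 : ℝ) < d 0 := by exact_mod_cast h0
  rw [pierceSeries_eq hd h0]
  gcongr
  linarith

/-- The Pierce series as a point of the unit interval. -/
noncomputable def piercePoint (hd : StrictMono d) (h0 : 0 < d 0) : I :=
  ⟨pierceSeries d, pierceSeries_nonneg hd h0, (pierceSeries_le hd h0).trans
    (div_le_one_of_le₀ (by exact_mod_cast h0) (by positivity))⟩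

theorem piercePoint_eq (hd : StrictMono d) (h0 : 0 < d 0) :
    piercePoint hd h0 = inverseBranch h0
      (piercePoint (strictMono_tail hd) (pos_of_strictMono hd h0 1)) :=
  Subtype.ext (pierceSeries_eq hd h0)

theorem piercePoint_tail_lt (hd : StrictMono d) (h0 : 0 < d 0) :
    (piercePoint (strictMono_tail hd) (pos_of_strictMono hd h0 1) : ℝ) < 1 / (d 0 + 1) := by
  refine (pierceSeries_lt (strictMono_tail hd) (pos_of_strictMono hd h0 1)).trans_le ?_
  have h1 : d 0 < d 1 := hd Nat.zero_lt_one
  exact one_div_le_one_div_of_le (by positivity) (by exact_mod_cast h1)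

theorem firstDigit_piercePoint (hd : StrictMono d) (h0 : 0 < d 0) :
    firstDigit (piercePoint hd h0) = d 0 := by
  rw [piercePoint_eq hd h0, firstDigit_inverseBranch h0 (piercePoint_tail_lt hd h0)]

theorem shift_piercePoint (hd : StrictMono d) (h0 : 0 < d 0) :
    shift (piercePoint hd h0) = piercePoint (strictMono_tail hd) (pos_of_strictMono hd h0 1) := by
  rw [piercePoint_eq hd h0, shift_inverseBranch h0 (piercePoint_tail_lt hd h0)]

theorem firstDigit_iterate_shift (k : ℕ) : ∀ {d : ℕ → ℕ} (hd : StrictMono d) (h0 : 0 < d 0),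
    firstDigit (shift^[k] (piercePoint hd h0)) = d k := by
  induction k with
  | zero => exact fun hd h0 => firstDigit_piercePoint hd h0
  | succ k ih =>
    intro d hd h0
    rw [Function.iterate_succ_apply, shift_piercePoint hd h0, ih]

end Series

/-! ### Separation of Pierce series -/

/-- With `a = d 0` and `b = e 0`, the condition `b < d 1` keeps the first series away from the end
of its cylinder: it is at least `(1 - 1 / (b + 1)) / a`, while the second is at most `1 / b`. The
difference of these bounds has numerator `b ^ 2 - a * (b + 1) ≥ 1`, as `a ≤ b - 1`. -/
theorem pierceSeries_sub_of_lt {d e : ℕ → ℕ} (hd : StrictMono d) (hd0 : 0 < d 0)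
    (he : StrictMono e) (he0 : 0 < e 0) {D : ℕ} (h : d 0 < e 0) (h1 : e 0 < d 1) (h2 : e 0 < D) :
    1 / (D : ℝ) ^ 3 ≤ pierceSeries d - pierceSeries e := by
  have hx := pierceSeries_le he he0
  have hy := pierceSeries_le (strictMono_tail hd) (pos_of_strictMono hd hd0 1)
  rw [pierceSeries_eq hd hd0]
  set y := pierceSeries fun k => d (k + 1)
  have a0 : (1 : ℝ) ≤ d 0 := by exact_mod_cast hd0
  have a1 : (d 0 : ℝ) + 1 ≤ e 0 := by exact_mod_cast h
  have a2 : (e 0 : ℝ) + 1 ≤ d 1 := by exact_mod_cast h1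
  have a3 : (e 0 : ℝ) + 1 ≤ D := by exact_mod_cast h2
  have hy' : y ≤ 1 / (e 0 + 1) := hy.trans (one_div_le_one_div_of_le (by linarith) a2)
  generalize (d 0 : ℝ) = a at *
  generalize (e 0 : ℝ) = b at *
  have hb : 0 < b := by linarith
  have hlow : (1 - 1 / (b + 1)) / a ≤ (1 - y) / a := by gcongr
  have hid : (1 - 1 / (b + 1)) / a - 1 / b = (b ^ 2 - a * (b + 1)) / (a * b * (b + 1)) := by
    field_simp
    ring
  have hge : 1 / (a * b * (b + 1)) ≤ (b ^ 2 - a * (b + 1)) / (a * b * (b + 1)) := by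
    gcongr
    nlinarith
  have hD : 1 / (D : ℝ) ^ 3 ≤ 1 / (a * b * (b + 1)) := by
    refine one_div_le_one_div_of_le (by positivity) ?_
    calc a * b * (b + 1) ≤ D * D * D := by gcongr <;> linarith
      _ = (D : ℝ) ^ 3 := by ring
  linarith

/-- Removing a common first digit multiplies the distance by `d 0 ≤ D 0`, which reduces to sequences
that differ at once. The bounds `D` separate consecutive windows, so the base case applies whichever
digit is smaller. -/
theorem le_abs_pierceSeries_sub (n : ℕ) : ∀ {d e D : ℕ → ℕ}, StrictMono d → 0 < d 0 →
    StrictMono e → 0 < e 0 → (∀ k, d k < D k) → (∀ k, e k < D k) →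
    (∀ k, D k ≤ d (k + 1)) → (∀ k, D k ≤ e (k + 1)) →
    (∀ k < n, d k = e k) → d n ≠ e n →
    1 / ((∏ k ∈ range n, (D k : ℝ)) * (D n : ℝ) ^ 3) ≤ |pierceSeries d - pierceSeries e| := by
  induction n with
  | zero =>
    intro d e D hd hd0 he he0 hdD heD hDd hDe _ hne
    rw [range_zero, prod_empty, one_mul]
    rcases lt_or_gt_of_ne hne with h | h
    · exact (pierceSeries_sub_of_lt hd hd0 he he0 h ((heD 0).trans_le (hDd 0)) (heD 0)).trans
        (le_abs_self _)
    · rw [abs_sub_comm]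
      exact (pierceSeries_sub_of_lt he he0 hd hd0 h ((hdD 0).trans_le (hDe 0)) (hdD 0)).trans
        (le_abs_self _)
  | succ n ih =>
    intro d e D hd hd0 he he0 hdD heD hDd hDe heq hne
    have h := ih (D := fun k => D (k + 1)) (strictMono_tail hd) (pos_of_strictMono hd hd0 1)
      (strictMono_tail he) (pos_of_strictMono he he0 1) (fun k => hdD _) (fun k => heD _)
      (fun k => hDd _) (fun k => hDe _) (fun k hk => heq _ (Nat.succ_lt_succ hk)) hne
    have h0 : d 0 = e 0 := heq 0 n.succ_pos
    have hd0' : (0 : ℝ) < d 0 := by exact_mod_cast hd0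
    have hdD' : (d 0 : ℝ) ≤ D 0 := by exact_mod_cast (hdD 0).le
    rw [pierceSeries_eq hd hd0, pierceSeries_eq he he0, ← h0, ← sub_div, abs_div,
      abs_of_pos hd0', sub_sub_sub_cancel_left, abs_sub_comm, le_div_iff₀ hd0']
    refine le_trans ?_ h
    rw [prod_range_succ']
    set A := ∏ k ∈ range n, (D (k + 1) : ℝ)
    have hApos : 0 ≤ A := by positivity
    have hDp : (0 : ℝ) < D 0 := hd0'.trans_le hdD'
    calc 1 / (A * D 0 * D (n + 1) ^ 3) * d 0
        ≤ 1 / (A * D 0 * D (n + 1) ^ 3) * D 0 := by gcongr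
      _ = 1 / (A * D (n + 1) ^ 3) := by
        rw [mul_right_comm, one_div, mul_inv, one_div, inv_mul_cancel_right₀ hDp.ne']

/-! ### Coding points of `[0, 1)` by digits in prescribed windows -/

/-- The digits `M k + e k`, where the `e k` are the digits of `t` in the mixed radix system
with bases `M (k + 1) - M k`. -/
noncomputable def codedDigit (M : ℕ → ℕ) (t : ℝ) (k : ℕ) : ℕ :=
  M k + ⌊((∏ i ∈ range (k + 1), (M (i + 1) - M i) : ℕ) : ℝ) * t⌋₊ % (M (k + 1) - M k)

section Coding

variable {M : ℕ → ℕ}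

theorem le_codedDigit (t : ℝ) (k : ℕ) : M k ≤ codedDigit M t k := Nat.le_add_right _ _

theorem codedDigit_lt (hM : ∀ k, M k + 2 ≤ M (k + 1)) (t : ℝ) (k : ℕ) :
    codedDigit M t k < M (k + 1) := by
  have := hM k
  have := Nat.mod_lt ⌊((∏ i ∈ range (k + 1), (M (i + 1) - M i) : ℕ) : ℝ) * t⌋₊
    (by omega : 0 < M (k + 1) - M k)
  unfold codedDigit
  omega

theorem strictMono_codedDigit (hM : ∀ k, M k + 2 ≤ M (k + 1)) (t : ℝ) :
    StrictMono (codedDigit M t) :=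
  strictMono_nat_of_lt_succ fun k => (codedDigit_lt hM t k).trans_le (le_codedDigit t (k + 1))

theorem abs_sub_le_of_floor_eq {P t u : ℝ} (hP : 0 < P) (ht : 0 ≤ t) (hu : 0 ≤ u)
    (h : ⌊P * t⌋₊ = ⌊P * u⌋₊) : |t - u| ≤ 1 / P := by
  have a1 := Nat.floor_le (mul_nonneg hP.le ht)
  have a2 := Nat.floor_le (mul_nonneg hP.le hu)
  have a3 := Nat.lt_floor_add_one (P * t)
  have a4 := Nat.lt_floor_add_one (P * u)
  rw [h] at a1 a3
  rw [le_div_iff₀ hP]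
  calc |t - u| * P = |(t - u) * P| := by rw [abs_mul, abs_of_pos hP]
    _ ≤ 1 := abs_le.mpr ?_
  constructor <;> nlinarith

theorem two_pow_le_prod_sub (hM : ∀ k, M k + 2 ≤ M (k + 1)) (n : ℕ) :
    2 ^ n ≤ ∏ i ∈ range n, (M (i + 1) - M i) := by
  calc 2 ^ n = ∏ _i ∈ range n, 2 := by simp
    _ ≤ _ := prod_le_prod' fun i _ => by have := hM i; omega

/-- At the first level where the mixed radix truncations of `t` and `u` differ, the previous
truncations still agree. This bounds `|t - u|` and makes the last digit the first one to differ. -/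
theorem exists_codedDigit_ne (hM : ∀ k, M k + 2 ≤ M (k + 1)) {t u : ℝ}
    (ht : t ∈ Set.Ico (0 : ℝ) 1) (hu : u ∈ Set.Ico (0 : ℝ) 1) (htu : t ≠ u) :
    ∃ n, (∀ k < n, codedDigit M t k = codedDigit M u k) ∧ codedDigit M t n ≠ codedDigit M u n ∧
      |t - u| ≤ 1 / ((∏ i ∈ range n, (M (i + 1) - M i) : ℕ) : ℝ) := by
  set P : ℕ → ℕ := fun n => ∏ i ∈ range n, (M (i + 1) - M i) with hPdef
  have hP : ∀ n, (0 : ℝ) < P n := fun n => by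
    exact_mod_cast (pow_pos two_pos n).trans_le (two_pow_le_prod_sub hM n)
  have hex : ∃ n, ⌊(P n : ℝ) * t⌋₊ ≠ ⌊(P n : ℝ) * u⌋₊ := by
    by_contra! hall
    obtain ⟨n, hn⟩ := exists_pow_lt_of_lt_one (abs_pos.mpr (sub_ne_zero.mpr htu))
      (by norm_num : (1 / 2 : ℝ) < 1)
    have h1 := abs_sub_le_of_floor_eq (hP n) ht.1 hu.1 (hall n)
    have h2 : (1 : ℝ) / P n ≤ (1 / 2) ^ n := by
      rw [one_div_pow]
      exact one_div_le_one_div_of_le (by positivity) (by exact_mod_cast two_pow_le_prod_sub hM n)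
    linarith
  classical
  have hspec := Nat.find_spec hex
  have hmin : ∀ k < Nat.find hex, ⌊(P k : ℝ) * t⌋₊ = ⌊(P k : ℝ) * u⌋₊ :=
    fun k hk => not_not.mp (Nat.find_min hex hk)
  obtain ⟨n, hn⟩ : ∃ n, Nat.find hex = n + 1 := by
    refine Nat.exists_eq_succ_of_ne_zero fun h0 => hspec ?_
    rw [h0]
    simp only [hPdef, range_zero, prod_empty, Nat.cast_one, one_mul]
    rw [Nat.floor_eq_zero.mpr ht.2, Nat.floor_eq_zero.mpr hu.2]
  rw [hn] at hspec hmin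
  refine ⟨n, fun k hk => ?_, fun heq => hspec ?_,
    abs_sub_le_of_floor_eq (hP n) ht.1 hu.1 (hmin n n.lt_succ_self)⟩
  · simp only [codedDigit]
    rw [show ⌊((∏ i ∈ range (k + 1), (M (i + 1) - M i) : ℕ) : ℝ) * t⌋₊ = _ from
      hmin (k + 1) (Nat.succ_lt_succ hk)]
  · have hN : ((M (n + 1) - M n : ℕ) : ℝ) ≠ 0 := by
      have := hM n
      exact_mod_cast (by omega : M (n + 1) - M n ≠ 0)
    have hdiv : ∀ v : ℝ, ⌊(P (n + 1) : ℝ) * v⌋₊ / (M (n + 1) - M n) = ⌊(P n : ℝ) * v⌋₊ := by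
      intro v
      rw [← Nat.floor_div_natCast]
      congr 1
      simp only [hPdef, prod_range_succ, Nat.cast_mul]
      field_simp
    have hmod := Nat.add_left_cancel heq
    change ⌊(P (n + 1) : ℝ) * t⌋₊ % _ = ⌊(P (n + 1) : ℝ) * u⌋₊ % _ at hmod
    rw [← Nat.div_add_mod ⌊(P (n + 1) : ℝ) * t⌋₊ (M (n + 1) - M n), hdiv, hmod,
      hmin n n.lt_succ_self, ← hdiv, Nat.div_add_mod]

/-- Compares the separation scale of the points with the scale of the parameter; `hgap` bounds the
`r`-th power of the ratio of successive separation scales by the number of choices for one digit, so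
the product telescopes. -/
theorem rpow_prod_le (hM0 : ∀ k, 0 < M k) {r : ℝ}
    (hgap : ∀ n, ((M (n + 2) : ℝ) ^ 3 / (M (n + 1) : ℝ) ^ 2) ^ r ≤ (M (n + 1) - M n : ℕ)) (n : ℕ) :
    ((∏ k ∈ range n, (M (k + 1) : ℝ)) * (M (n + 1) : ℝ) ^ 3) ^ r ≤
      ((M 1 : ℝ) ^ 3) ^ r * (∏ i ∈ range n, (M (i + 1) - M i) : ℕ) := by
  induction n with
  | zero => simp
  | succ n ih =>
    have hpos : (0 : ℝ) < M (n + 1) := by exact_mod_cast hM0 (n + 1)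
    have hid : (∏ k ∈ range (n + 1), (M (k + 1) : ℝ)) * (M (n + 1 + 1) : ℝ) ^ 3 =
        ((∏ k ∈ range n, (M (k + 1) : ℝ)) * (M (n + 1) : ℝ) ^ 3) *
          ((M (n + 2) : ℝ) ^ 3 / (M (n + 1) : ℝ) ^ 2) := by
      rw [prod_range_succ]
      field_simp
    rw [hid, Real.mul_rpow (by positivity) (by positivity), prod_range_succ, Nat.cast_mul,
      ← mul_assoc]
    exact mul_le_mul ih (hgap n) (by positivity) (by positivity)

theorem le_dimH_of_branch (hM : ∀ k, M k + 2 ≤ M (k + 1)) (hM0 : 0 < M 0) {r : ℝ} (hr : 0 < r)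
    (hgap : ∀ n, ((M (n + 2) : ℝ) ^ 3 / (M (n + 1) : ℝ) ^ 2) ^ r ≤ (M (n + 1) - M n : ℕ))
    {G : I → I} {a b δ : ℝ} (hb : b ≠ 0) (hG : ∀ y : I, (y : ℝ) < δ → (G y : ℝ) = a + b * y)
    (hδ : 1 / (M 0 : ℝ) < δ) {X : Set I}
    (hX : ∀ (d : ℕ → ℕ) (hd : StrictMono d) (h0 : 0 < d 0),
      (∀ k, M k ≤ d k ∧ d k < M (k + 1)) → (piercePoint hd h0 : ℝ) < δ →
        G (piercePoint hd h0) ∈ X) :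
    ENNReal.ofReal r ≤ dimH X := by
  have hMpos : ∀ k, 0 < M k := fun k => by
    induction k with
    | zero => exact hM0
    | succ k _ => have := hM k; omega
  have hd := strictMono_codedDigit hM
  have h0 : ∀ t, 0 < codedDigit M t 0 := fun t => hM0.trans_le (le_codedDigit t 0)
  have hlt : ∀ t, (piercePoint (hd t) (h0 t) : ℝ) < δ := fun t => by
    refine (pierceSeries_lt (hd t) (h0 t)).trans_le (le_trans ?_ hδ.le)
    exact one_div_le_one_div_of_le (by exact_mod_cast hM0) (by exact_mod_cast le_codedDigit t 0)
  refine le_dimH_of_le_mul_rpow (F := fun t => G (piercePoint (hd t) (h0 t)))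
    (C := ((M 1 : ℝ) ^ 3) ^ r * (|b|⁻¹) ^ r) hr (by positivity)
    (fun t _ => hX _ _ _ (fun k => ⟨le_codedDigit t k, codedDigit_lt hM t k⟩) (hlt t))
    fun t ht u hu => ?_
  rcases eq_or_ne t u with rfl | htu
  · rw [sub_self, abs_zero]; positivity
  obtain ⟨n, heq, hne, hle⟩ := exists_codedDigit_ne hM ht hu htu
  have hsep := le_abs_pierceSeries_sub n (D := fun k => M (k + 1)) (hd t) (h0 t) (hd u) (h0 u)
    (codedDigit_lt hM t) (codedDigit_lt hM u) (fun k => le_codedDigit t (k + 1))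
    (fun k => le_codedDigit u (k + 1)) heq hne
  have hprod := rpow_prod_le hMpos hgap n
  set P : ℝ := ((∏ i ∈ range n, (M (i + 1) - M i) : ℕ) : ℝ)
  have hP : 0 < P := by
    exact Nat.cast_pos.mpr ((pow_pos two_pos n).trans_le (two_pow_le_prod_sub hM n))
  set Q : ℝ := (∏ k ∈ range n, (M (k + 1) : ℝ)) * (M (n + 1) : ℝ) ^ 3
  have hQ : 0 < Q := by
    have := hMpos (n + 1)
    have := prod_pos (s := range n) (f := fun k => (M (k + 1) : ℝ))
      fun k _ => by exact_mod_cast hMpos (k + 1)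
    positivity
  have hdist : |(G (piercePoint (hd t) (h0 t)) : ℝ) - G (piercePoint (hd u) (h0 u))| =
      |b| * |pierceSeries (codedDigit M t) - pierceSeries (codedDigit M u)| := by
    rw [hG _ (hlt t), hG _ (hlt u), add_sub_add_left_eq_sub, ← mul_sub, abs_mul]
    rfl
  rw [hdist, mul_assoc, ← Real.mul_rpow (by positivity) (by positivity),
    inv_mul_cancel_left₀ (abs_ne_zero.mpr hb)]
  calc |t - u| ≤ 1 / P := hle
    _ ≤ ((M 1 : ℝ) ^ 3) ^ r * (1 / Q) ^ r := by
      rw [Real.div_rpow zero_le_one hQ.le, Real.one_rpow, mul_one_div,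
        div_le_div_iff₀ hP (Real.rpow_pos_of_pos hQ r), one_mul]
      exact hprod
    _ ≤ _ := by gcongr

end Coding

/-! ### Windows with prescribed growth -/

/-- The windows `[⌈exp (h n)⌉, ⌈exp (h (n + 1))⌉)` grow slowly enough, and are long enough,
to carry subsets of almost full dimension. -/
theorem eventually_window {h : ℕ → ℝ} (h0 : ∀ n, 0 ≤ h n) {κ : ℝ} (hκ : 0 < κ)
    (hsq : ∀ n, κ ≤ h (n + 1) ^ 2 - h n ^ 2) (htop : Tendsto h atTop atTop)
    (hratio : Tendsto (fun n => h (n + 1) / h n) atTop (𝓝 1)) {r : ℝ} (hr : 0 < r) (hr1 : r < 1) :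
    ∀ᶠ n in atTop, ⌈Real.exp (h n)⌉₊ + 2 ≤ ⌈Real.exp (h (n + 1))⌉₊ ∧
      ((⌈Real.exp (h (n + 2))⌉₊ : ℝ) ^ 3 / (⌈Real.exp (h (n + 1))⌉₊ : ℝ) ^ 2) ^ r ≤
        (⌈Real.exp (h (n + 1))⌉₊ - ⌈Real.exp (h n)⌉₊ : ℕ) := by
  obtain ⟨ρ, hrρ, hρ1⟩ := exists_between hr1
  have hcoef : Tendsto (fun n => r * (3 * (h (n + 1 + 1) / h (n + 1)) * (h (n + 1) / h n) -
      2 * (h (n + 1) / h n))) atTop (𝓝 (r * (3 * 1 * 1 - 2 * 1))) :=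
    ((((hratio.comp (tendsto_add_atTop_nat 1)).const_mul 3).mul hratio).sub
      (hratio.const_mul 2)).const_mul r
  have hcoef' := hcoef.eventually_lt_const (u := ρ) (by linarith)
  filter_upwards [hcoef', hratio.eventually_lt_const one_lt_two,
    -- The threshold `54 / (κ * (1 - ρ) ^ 2)` is what `key` needs when the exponential is bounded
    -- below by its quadratic term.
    htop.eventually_ge_atTop (54 / (κ * (1 - ρ) ^ 2)), htop.eventually_gt_atTop 0]
    with n hn1 hn2 hn3 hn4
  have hmono : ∀ k, h k < h (k + 1) := fun k =>
    lt_of_pow_lt_pow_left₀ 2 (h0 _) (by linarith [hsq k])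
  have hb0 := hn4.trans (hmono n)
  have ha1 : h n < h (n + 1) := hmono n
  have hab := hsq n
  rw [div_lt_iff₀ hn4] at hn2
  have hexp : r * (3 * h (n + 2) - 2 * h (n + 1)) ≤ ρ * h n := by
    have : r * (3 * h (n + 2) - 2 * h (n + 1)) = r * (3 * (h (n + 1 + 1) / h (n + 1)) *
        (h (n + 1) / h n) - 2 * (h (n + 1) / h n)) * h n := by
      field_simp
    rw [this]
    gcongr
  have hc : 0 ≤ h (n + 2) := h0 _
  generalize h (n + 2) = c at *
  generalize h (n + 1) = b at *
  generalize h n = a at *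
  have hρ : 0 < 1 - ρ := by linarith
  rw [div_le_iff₀ (by positivity)] at hn3
  have key : 27 * a ≤ κ * Real.exp ((1 - ρ) * a) := by
    have := Real.quadratic_le_exp_of_nonneg (mul_nonneg hρ.le hn4.le)
    calc 27 * a = (54 * a) / 2 := by ring
      _ ≤ (a * (κ * (1 - ρ) ^ 2)) * a / 2 := by gcongr
      _ = κ * (((1 - ρ) * a) ^ 2 / 2) := by ring
      _ ≤ κ * Real.exp ((1 - ρ) * a) := by
        gcongr
        have := mul_nonneg hρ.le hn4.le
        linarith
  -- Of the factor `9`, `8 = 2 ^ 3` absorbs the ceiling in the cubed term and `1` the rounding of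
  -- the window length.
  have hmain : 9 * Real.exp (ρ * a) ≤ Real.exp b - Real.exp a := by
    have e1 : Real.exp a * (b - a) ≤ Real.exp b - Real.exp a := by
      have := Real.add_one_le_exp (b - a)
      have h2 : Real.exp b = Real.exp a * Real.exp (b - a) := by
        rw [← Real.exp_add]; ring_nf
      rw [h2]
      nlinarith [Real.exp_pos a]
    -- From `κ ≤ (b - a) * (b + a)` and `b < 2 * a`.
    have e2 : κ / (3 * a) ≤ b - a := by
      rw [div_le_iff₀ (by linarith)]
      nlinarith
    have e3 : Real.exp a = Real.exp (ρ * a) * Real.exp ((1 - ρ) * a) := by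
      rw [← Real.exp_add]; ring_nf
    calc 9 * Real.exp (ρ * a) = Real.exp (ρ * a) * (27 * a / (3 * a)) := by field_simp; norm_num
      _ ≤ Real.exp (ρ * a) * (κ * Real.exp ((1 - ρ) * a) / (3 * a)) := by gcongr
      _ = Real.exp a * (κ / (3 * a)) := by rw [e3]; ring
      _ ≤ Real.exp a * (b - a) := by gcongr
      _ ≤ _ := e1
  have hρa : 1 ≤ Real.exp (ρ * a) := Real.one_le_exp (mul_nonneg (hr.trans hrρ).le hn4.le)
  have u1 := Nat.ceil_lt_add_one (Real.exp_pos a).le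
  have u2 := Nat.le_ceil (Real.exp b)
  have u3 : (⌈Real.exp c⌉₊ : ℝ) ≤ 2 * Real.exp c := by
    have := Nat.ceil_lt_add_one (Real.exp_pos c).le
    have := Real.one_le_exp hc
    linarith
  have hlen : ⌈Real.exp a⌉₊ + 2 ≤ ⌈Real.exp b⌉₊ := by
    have : (⌈Real.exp a⌉₊ : ℝ) + 2 ≤ ⌈Real.exp b⌉₊ := by linarith
    exact_mod_cast this
  refine ⟨hlen, ?_⟩
  rw [Nat.cast_sub (by omega)]
  calc ((⌈Real.exp c⌉₊ : ℝ) ^ 3 / (⌈Real.exp b⌉₊ : ℝ) ^ 2) ^ r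
      ≤ ((2 * Real.exp c) ^ 3 / (Real.exp b) ^ 2) ^ r := by gcongr
    _ = (8 * Real.exp (3 * c - 2 * b)) ^ r := by
      congr 1
      rw [Real.exp_sub, mul_pow, ← Real.exp_nat_mul, ← Real.exp_nat_mul]
      norm_num
      ring
    _ = 8 ^ r * Real.exp (r * (3 * c - 2 * b)) := by
      rw [Real.mul_rpow (by norm_num) (Real.exp_pos _).le, ← Real.exp_mul, mul_comm r]
    _ ≤ 8 ^ (1 : ℝ) * Real.exp (ρ * a) := by gcongr; norm_num
    _ ≤ ⌈Real.exp b⌉₊ - ⌈Real.exp a⌉₊ := by rw [Real.rpow_one]; linarith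

/-! ### Digit growth and the dimension of the growth sets -/

theorem tendsto_add_div {h : ℕ → ℝ} {α : ℝ≥0∞}
    (hlim : Tendsto (fun n : ℕ => ((h n / n : ℝ) : EReal)) atTop (𝓝 (α : EReal)))
    (i j : ℕ) (c : ℝ) :
    Tendsto (fun k : ℕ => (((h (k + i) + c) / (k + j : ℕ) : ℝ) : EReal)) atTop
      (𝓝 (α : EReal)) := by
  have hj : Tendsto (fun k : ℕ => ((k + j : ℕ) : ℝ)) atTop atTop :=
    tendsto_natCast_atTop_atTop.comp (tendsto_add_atTop_nat j)
  have h1 := hlim.comp (tendsto_add_atTop_nat i)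
  have h2 : Tendsto (fun k : ℕ => ((k + i : ℕ) : ℝ) / (k + j : ℕ)) atTop (𝓝 1) := by
    have : Tendsto (fun k : ℕ => 1 + ((i : ℝ) - j) / (k + j : ℕ)) atTop (𝓝 (1 + 0)) :=
      (hj.const_div_atTop _).const_add 1
    rw [add_zero] at this
    refine this.congr' ?_
    filter_upwards [eventually_gt_atTop 0] with k hk
    have : ((k + j : ℕ) : ℝ) ≠ 0 := by positivity
    field_simp
    push_cast
    ring
  have h3 : Tendsto (fun k : ℕ => c / (k + j : ℕ)) atTop (𝓝 0) := hj.const_div_atTop c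
  have h2' := EReal.tendsto_coe.mpr h2
  have h3' := EReal.tendsto_coe.mpr h3
  have hmul := (EReal.continuousAt_mul (p := ((α : EReal), ((1 : ℝ) : EReal)))
    (.inr (EReal.coe_ne_bot 1)) (.inr (EReal.coe_ne_top 1)) (by simp) (by simp)).tendsto.comp
      (h1.prodMk_nhds h2')
  have hadd := (EReal.continuousAt_add (p := ((α : EReal) * ((1 : ℝ) : EReal), ((0 : ℝ) : EReal)))
    (by simp) (by simp)).tendsto.comp (hmul.prodMk_nhds h3')
  simp only [EReal.coe_one, mul_one, EReal.coe_zero, add_zero] at hadd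
  refine hadd.congr' ?_
  filter_upwards [eventually_gt_atTop 0] with k hk
  have e1 : ((k + j : ℕ) : ℝ) ≠ 0 := by positivity
  have e2 : ((k + i : ℕ) : ℝ) ≠ 0 := by positivity
  simp only [Function.comp_apply]
  rw [← EReal.coe_mul, ← EReal.coe_add]
  congr 1
  field_simp

theorem mem_growthSet_of_window {h : ℕ → ℝ} (h0 : ∀ n, 0 ≤ h n) {α : ℝ≥0∞}
    (hlim : Tendsto (fun n : ℕ => ((h n / n : ℝ) : EReal)) atTop (𝓝 (α : EReal)))
    {d : ℕ → ℕ} (hd : StrictMono d) (hd0 : 0 < d 0) {i m : ℕ}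
    (hlo : ∀ k, ⌈Real.exp (h (k + i))⌉₊ ≤ d k) (hhi : ∀ k, d k < ⌈Real.exp (h (k + 1 + i))⌉₊)
    {z : I} (hz : shift^[m] z = piercePoint hd hd0) : z ∈ growthSet α := by
  -- The `m` prepended digits are dropped; one more index is lost because `digit` counts from `1`
  -- and `d` from `0`.
  rw [growthSet, Set.mem_ofPred_eq, ← tendsto_add_atTop_iff_nat (m + 1)]
  have hdigit : ∀ k, digit (k + (m + 1)) z = d k := fun k => by
    rw [digit, ← add_assoc, Nat.add_sub_cancel, Function.iterate_add_apply, hz,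
      firstDigit_iterate_shift]
  have hval : ∀ k, ENNReal.log ((digit (k + (m + 1)) z : ℕ∞) : ℝ≥0∞) / ((k + (m + 1) : ℕ) : EReal) =
      ((Real.log (d k) / (k + (m + 1) : ℕ) : ℝ) : EReal) := fun k => by
    have hpos : (0 : ℝ) < d k := by exact_mod_cast pos_of_strictMono hd hd0 k
    rw [hdigit, ENat.toENNReal_coe, ← ENNReal.ofReal_natCast, ENNReal.log_ofReal_of_pos hpos,
      EReal.coe_div]
    rfl
  simp only [hval]
  -- The `log 2` comes from `⌈exp s⌉ ≤ 2 * exp s` for `s ≥ 0`.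
  refine tendsto_of_tendsto_of_tendsto_of_le_of_le (tendsto_add_div hlim i (m + 1) 0)
    (tendsto_add_div hlim (1 + i) (m + 1) (Real.log 2)) (fun k => ?_) (fun k => ?_)
  · have hpos : (0 : ℝ) < d k := by exact_mod_cast pos_of_strictMono hd hd0 k
    refine EReal.coe_le_coe_iff.mpr (div_le_div_of_nonneg_right ?_ (by positivity))
    rw [add_zero, Real.le_log_iff_exp_le hpos]
    exact (Nat.le_ceil _).trans (by exact_mod_cast hlo k)
  · have hpos : (0 : ℝ) < d k := by exact_mod_cast pos_of_strictMono hd hd0 k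
    refine EReal.coe_le_coe_iff.mpr (div_le_div_of_nonneg_right ?_ (by positivity))
    rw [Real.log_le_iff_le_exp hpos, Real.exp_add, Real.exp_log two_pos, ← add_assoc]
    have h1 : (d k : ℝ) < ⌈Real.exp (h (k + 1 + i))⌉₊ := by exact_mod_cast hhi k
    have h2 := Nat.ceil_lt_add_one (Real.exp_pos (h (k + 1 + i))).le
    have h3 := Real.one_le_exp (h0 (k + 1 + i))
    linarith

theorem dimH_inter_growthSet_of_window {h : ℕ → ℝ} (h0 : ∀ n, 0 ≤ h n) {κ : ℝ} (hκ : 0 < κ)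
    (hsq : ∀ n, κ ≤ h (n + 1) ^ 2 - h n ^ 2) (htop : Tendsto h atTop atTop)
    (hratio : Tendsto (fun n => h (n + 1) / h n) atTop (𝓝 1)) {α : ℝ≥0∞}
    (hlim : Tendsto (fun n : ℕ => ((h n / n : ℝ) : EReal)) atTop (𝓝 (α : EReal)))
    {U : Set I} (hU : IsOpen U) (hne : U.Nonempty) : dimH (U ∩ growthSet α) = 1 := by
  refine le_antisymm ?_ ?_
  · calc dimH (U ∩ growthSet α) = dimH (((↑) : I → ℝ) '' (U ∩ growthSet α)) :=
        (isometry_subtype_coe.dimH_image _).symm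
      _ ≤ dimH (Set.univ : Set ℝ) := dimH_mono (Set.subset_univ _)
      _ = 1 := Real.dimH_univ
  obtain ⟨x, hxU, hx⟩ := exists_mem_hasNearbyBranches hU hne
  obtain ⟨ε, hε, hball⟩ := Metric.isOpen_iff.mp hU x hxU
  obtain ⟨m, a, b, δ, hb, hδ, H⟩ := hx ε hε
  choose! G hG1 hG2 hG3 using H
  refine le_of_forall_lt fun s hs => ?_
  obtain ⟨s', hs1, hs2⟩ := exists_between hs
  lift s' to NNReal using hs2.ne_top
  have hr1 : (s' : ℝ) < 1 := by exact_mod_cast hs2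
  have hr : 0 < (s' : ℝ) := by exact_mod_cast (zero_le.trans_lt hs1)
  refine hs1.trans_le ?_
  have hM0 : ∀ᶠ n in atTop, 1 / δ < (⌈Real.exp (h n)⌉₊ : ℝ) := by
    filter_upwards [(Real.tendsto_exp_atTop.comp htop).eventually_gt_atTop (1 / δ)] with n hn
    exact lt_of_lt_of_le hn (Nat.le_ceil _)
  -- Starting the windows at `i` gives the size conditions for the exponent `s'` and puts the coded
  -- points in the domain of the affine branch.
  obtain ⟨i, hi⟩ := eventually_atTop.mp
    ((eventually_window h0 hκ hsq htop hratio hr hr1).and hM0)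
  rw [← ENNReal.ofReal_coe_nnreal]
  refine le_dimH_of_branch (M := fun k => ⌈Real.exp (h (k + i))⌉₊) (a := a) (b := b) (δ := δ) (G := G)
    (fun k => ?_) (Nat.ceil_pos.mpr (Real.exp_pos _)) hr (fun k => ?_) hb hG1 ?_
    fun d hd hd0 hwin hlt => ⟨hball ?_, ?_⟩
  · have := (hi (k + i) (Nat.le_add_left _ _)).1.1
    rwa [add_right_comm] at this
  · have := (hi (k + i) (Nat.le_add_left _ _)).1.2
    rwa [add_right_comm k i 1, add_right_comm k i 2] at this
  · have := (hi (0 + i) (Nat.le_add_left _ _)).2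
    rwa [one_div_lt hδ (by positivity)] at this
  · rw [Metric.mem_ball, Subtype.dist_eq, Real.dist_eq]
    exact hG3 _ hlt
  · exact mem_growthSet_of_window h0 hlim hd hd0 (fun k => (hwin k).1) (fun k => (hwin k).2)
      (hG2 _ hlt)

theorem tendsto_succ_div_self : Tendsto (fun n : ℕ => ((n + 1 : ℕ) : ℝ) / n) atTop (𝓝 1) := by
  have : Tendsto (fun n : ℕ => 1 + 1 / (n : ℝ)) atTop (𝓝 (1 + 0)) :=
    tendsto_one_div_atTop_nhds_zero_nat.const_add 1
  rw [add_zero] at this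
  refine this.congr' ?_
  filter_upwards [eventually_gt_atTop 0] with n hn
  have : (n : ℝ) ≠ 0 := by positivity
  field_simp
  push_cast
  ring

/-- The growth functions are `n ^ 2`, `√n` and `α * n`. The spacing condition on squares of `h`
admits `√n`, whose increments tend to `0`, and the ratio condition still admits `n ^ 2`. -/
theorem dimH_inter_growthSet (α : ℝ≥0∞) {U : Set I} (hU : IsOpen U) (hne : U.Nonempty) :
    dimH (U ∩ growthSet α) = 1 := by
  have hnat : Tendsto (fun n : ℕ => (n : ℝ)) atTop atTop := tendsto_natCast_atTop_atTop
  rcases eq_or_ne α ⊤ with rfl | hα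
  · refine dimH_inter_growthSet_of_window (h := fun n => (n : ℝ) ^ 2) (fun n => by positivity)
      one_pos (fun n => ?_) ((tendsto_pow_atTop two_ne_zero).comp hnat) ?_ ?_ hU hne
    · push_cast
      have : (0 : ℝ) ≤ n := by positivity
      nlinarith [pow_nonneg this 2, pow_nonneg this 3]
    · simpa [div_pow] using tendsto_succ_div_self.pow 2
    · rw [EReal.coe_ennreal_top]
      refine EReal.tendsto_coe_nhds_top_iff.mpr (hnat.congr fun n => ?_)
      rw [sq, mul_self_div_self]
  rcases eq_or_ne α 0 with rfl | hα0
  · refine dimH_inter_growthSet_of_window (h := fun n => √(n : ℝ)) (fun n => by positivity)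
      one_pos (fun n => ?_) (Real.tendsto_sqrt_atTop.comp hnat) ?_ ?_ hU hne
    · rw [Real.sq_sqrt (by positivity), Real.sq_sqrt (by positivity)]
      push_cast
      linarith
    · have := (Real.continuous_sqrt.tendsto 1).comp tendsto_succ_div_self
      rw [Real.sqrt_one] at this
      exact this.congr fun n => Real.sqrt_div (by positivity) _
    · rw [EReal.coe_ennreal_zero, ← EReal.coe_zero]
      refine EReal.tendsto_coe.mpr ?_
      have := (Real.tendsto_sqrt_atTop.comp hnat).const_div_atTop 1
      exact this.congr fun n => by simp [Real.sqrt_div_self]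
  · have hpos : 0 < α.toReal := ENNReal.toReal_pos hα0 hα
    refine dimH_inter_growthSet_of_window (h := fun n => α.toReal * n) (fun n => by positivity)
      (pow_pos hpos 2) (fun n => ?_) (hnat.const_mul_atTop hpos) ?_ ?_ hU hne
    · push_cast
      have : (0 : ℝ) ≤ n := by positivity
      nlinarith [mul_nonneg (pow_pos hpos 2).le this]
    · exact tendsto_succ_div_self.congr fun n => (mul_div_mul_left _ _ hpos.ne').symm
    · rw [← EReal.coe_toReal (x := (α : EReal)) (by simpa using hα) (by simp)]
      refine EReal.tendsto_coe.mpr (tendsto_const_nhds.congr' ?_)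
      filter_upwards [eventually_gt_atTop 0] with n hn
      have : (n : ℝ) ≠ 0 := by positivity
      rw [mul_div_cancel_right₀ _ this, EReal.toReal_coe_ennreal]

end Pierce

theorem corollary1p2 (α : ℝ≥0∞) :
    Dense (Pierce.growthSet α) ∧
      ∀ U : Set I, IsOpen U → U.Nonempty → dimH (U ∩ Pierce.growthSet α) = 1 := by
  have hdim : ∀ U : Set I, IsOpen U → U.Nonempty → dimH (U ∩ Pierce.growthSet α) = 1 :=
    fun U hU hne => Pierce.dimH_inter_growthSet α hU hne
  refine ⟨dense_iff_inter_open.mpr fun U hU hne => ?_, hdim⟩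
  by_contra hempty
  have := hdim U hU hne
  rw [Set.not_nonempty_iff_eq_empty.mp hempty, dimH_empty] at this
  exact zero_ne_one this
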